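/- Let $k$ be a field, $\mathfrak g$ a finite-dimensional Lie algebra over $k$, and $R$ a semiprime $k$-algebra (no nonzero two-sided ideal of square zero) that is a homomorphic image of the enveloping algebra $U(\mathfrak g)$ via a surjective $k$-algebra map $\pi\colon U(\mathfrak g)\to R$. Let $Q_{\mathrm r}(R)=\varinjlim_{I}\operatorname{Hom}(I_R,R_R)$ be the right Amitsur–Martindale ring of quotients of $R$, where $I$ runs over the two-sided ideals of $R$ with $\{r\in R\mid rI=0\}=0$: its elements are the classes of right $R$-module maps $f\colon I_R\to R_R$, two maps being identified if they agree on some such ideal contained in both domains; addition is pointwise on $I\cap I'$, the product $ff'$ of $f\colon I\to R$ and $f'\colon I'\to R$ is the class of $f\circ f'\colon I'I\to R$, and $R$ is embedded by sending $r$ to left multiplication by $r$. A classical ring of quotients $Q_{\mathrm{cl}}(R)$ is a $k$-algebra containing $R$ as a subalgebra in which every regular element (nonzerodivisor on both sides) of $R$ is invertible and whose every element has the form $as^{-1}$ with $a,s\in R$, $s$ regular. Let $\operatorname{ad}\colon U(\mathfrak g)\to\operatorname{End}_k Q_{\mathrm{cl}}(R)$ be the algebra map with $\operatorname{ad}x(q)=\pi(x)q-q\pi(x)$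 for $x\in\mathfrak g$, and call $q\in Q_{\mathrm{cl}}(R)$ $\operatorname{ad}\mathfrak g$-finite if the $k$-subspace $\operatorname{ad}U(\mathfrak g)(q)$ is finite dimensional. Then $R$ has a classical ring of quotients, and for every classical ring of quotients $Q_{\mathrm{cl}}(R)$ of $R$ there is an injective ring homomorphism $Q_{\mathrm r}(R)\hookrightarrow Q_{\mathrm{cl}}(R)$ that is the identity on $R$ and whose image is exactly the set of all $\operatorname{ad}\mathfrak g$-finite elements of $Q_{\mathrm{cl}}(R)$. -/

import Mathlib

universe u v

/-! ### Semiprime rings and the filter of ideals with zero left annihilator -/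

/-- A ring is semiprime if it has no nonzero two-sided ideal of square zero. -/
def IsSemiprimeRing (R : Type*) [Ring R] : Prop :=
  ∀ I : TwoSidedIdeal R, (∀ x ∈ I, ∀ y ∈ I, x * y = 0) → I = ⊥

namespace AmitsurMartindale

open MulOpposite

variable {R : Type*} [Ring R]

/-- A right ideal `I` of `R` (a submodule of the right module `R_R`, i.e. over `Rᵐᵒᵖ`) belongs to
the filter `ℰ(R)` if it is a two-sided ideal whose left annihilator `{r | r I = 0}` is zero. -/
structure MemFilter (I : Submodule Rᵐᵒᵖ R) : Prop where
  mul_mem_left : ∀ (a : R) {x : R}, x ∈ I → a * x ∈ I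
  eq_zero_of_mul_eq_zero : ∀ r : R, (∀ x ∈ I, r * x = 0) → r = 0

theorem mul_mem_right (I : Submodule Rᵐᵒᵖ R) {x : R} (hx : x ∈ I) (a : R) : x * a ∈ I := by
  simpa using I.smul_mem (op a) hx

/-- The product `I J` of two right ideals: all finite sums of products `a * b`, `a ∈ I`, `b ∈ J`. -/
def mulIdeal (I J : Submodule Rᵐᵒᵖ R) : Submodule Rᵐᵒᵖ R :=
  Submodule.span Rᵐᵒᵖ {x | ∃ a ∈ I, ∃ b ∈ J, x = a * b}

theorem mulIdeal_le_left (I J : Submodule Rᵐᵒᵖ R) : mulIdeal I J ≤ I := by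
  refine Submodule.span_le.2 ?_
  rintro _ ⟨a, ha, b, -, rfl⟩
  exact mul_mem_right I ha b

theorem memFilter_top : MemFilter (⊤ : Submodule Rᵐᵒᵖ R) where
  mul_mem_left _ _ _ := trivial
  eq_zero_of_mul_eq_zero r h := by simpa using h 1 trivial

theorem MemFilter.mul {I J : Submodule Rᵐᵒᵖ R} (hI : MemFilter I) (hJ : MemFilter J) :
    MemFilter (mulIdeal I J) where
  mul_mem_left a x hx := by
    induction hx using Submodule.span_induction with
    | mem x h =>
      obtain ⟨b, hb, c, hc, rfl⟩ := h
      exact Submodule.subset_span ⟨a * b, hI.mul_mem_left a hb, c, hc, by rw [mul_assoc]⟩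
    | zero => simp
    | add x y _ _ hx hy => rw [mul_add]; exact add_mem hx hy
    | smul c x _ hx =>
      have h := (mulIdeal I J).smul_mem c hx
      rwa [← mul_smul_comm] at h
  eq_zero_of_mul_eq_zero r h := by
    refine hI.eq_zero_of_mul_eq_zero r fun a ha => hJ.eq_zero_of_mul_eq_zero _ fun b hb => ?_
    rw [mul_assoc]
    exact h _ (Submodule.subset_span ⟨a, ha, b, hb, rfl⟩)

theorem MemFilter.inf {I J : Submodule Rᵐᵒᵖ R} (hI : MemFilter I) (hJ : MemFilter J) :
    MemFilter (I ⊓ J) where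
  mul_mem_left a _ hx := ⟨hI.mul_mem_left a hx.1, hJ.mul_mem_left a hx.2⟩
  eq_zero_of_mul_eq_zero r h := by
    refine hI.eq_zero_of_mul_eq_zero r fun a ha => hJ.eq_zero_of_mul_eq_zero _ fun b hb => ?_
    rw [mul_assoc]
    exact h _ ⟨mul_mem_right I ha b, hJ.mul_mem_left a hb⟩

/-! ### The right Amitsur–Martindale ring of quotients -/

variable (R) in
/-- The right `R`-module maps `f : I_R → R_R` with `I ∈ ℰ(R)`. -/
structure PartialHom where
  toPMap : R →ₗ.[Rᵐᵒᵖ] R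
  memFilter : MemFilter toPMap.domain

namespace PartialHom

/-- Two maps are equivalent if they agree on some `J ∈ ℰ(R)` contained in both domains. -/
def Rel (f g : PartialHom R) : Prop :=
  ∃ J : Submodule Rᵐᵒᵖ R, MemFilter J ∧ J ≤ f.1.eqLocus g.1

theorem Rel.of_forall {f g : PartialHom R}
    (h : ∀ (x : R) (hf : x ∈ f.1.domain) (hg : x ∈ g.1.domain), f.1 ⟨x, hf⟩ = g.1 ⟨x, hg⟩) :
    Rel f g :=
  ⟨f.1.domain ⊓ g.1.domain, f.2.inf g.2, fun x hx => ⟨hx.1, hx.2, h x hx.1 hx.2⟩⟩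

variable (R) in
instance setoid : Setoid (PartialHom R) where
  r := Rel
  iseqv :=
    { refl := fun _ => Rel.of_forall fun _ _ _ => rfl
      symm := by
        rintro f g ⟨J, hJ, h⟩
        refine ⟨J, hJ, fun x hx => ?_⟩
        obtain ⟨h1, h2, h3⟩ := h hx
        exact ⟨h2, h1, h3.symm⟩
      trans := by
        rintro f g k ⟨J, hJ, h⟩ ⟨K, hK, h'⟩
        refine ⟨J ⊓ K, hJ.inf hK, fun x hx => ?_⟩
        obtain ⟨h1, h2, h3⟩ := h hx.1
        obtain ⟨_, h5, h6⟩ := h' hx.2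
        exact ⟨h1, h5, h3.trans h6⟩ }

/-- Left multiplication `λ_r : R → R`, `x ↦ r x`. -/
def lmul (r : R) : PartialHom R :=
  ⟨(LinearMap.mulLeft Rᵐᵒᵖ r).toPMap ⊤, memFilter_top⟩

theorem lmul_apply (r x : R) (hx : x ∈ (lmul r).1.domain) : (lmul r).1 ⟨x, hx⟩ = r * x := rfl

/-- The pointwise sum, defined on the intersection of the domains. -/
def add (f g : PartialHom R) : PartialHom R := ⟨f.1 + g.1, f.2.inf g.2⟩

theorem add_apply (f g : PartialHom R) (x : R) (hx : x ∈ (add f g).1.domain) :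
    (add f g).1 ⟨x, hx⟩ = f.1 ⟨x, hx.1⟩ + g.1 ⟨x, hx.2⟩ := rfl

/-- The pointwise negative. -/
def neg (f : PartialHom R) : PartialHom R := ⟨-f.1, f.2⟩

theorem neg_apply (f : PartialHom R) (x : R) (hx : x ∈ (neg f).1.domain) :
    (neg f).1 ⟨x, hx⟩ = -f.1 ⟨x, hx⟩ := rfl

theorem map_mul (f : PartialHom R) (a b : R) (ha : a ∈ f.1.domain) (hab : a * b ∈ f.1.domain) :
    f.1 ⟨a * b, hab⟩ = f.1 ⟨a, ha⟩ * b :=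
  f.1.map_smul (op b) ⟨a, ha⟩

theorem apply_mem (g : PartialHom R) {I : Submodule Rᵐᵒᵖ R} (hI : MemFilter I) {x : R}
    (hx : x ∈ mulIdeal g.1.domain I) :
    g.1 ⟨x, mulIdeal_le_left _ _ hx⟩ ∈ I := by
  have key : mulIdeal g.1.domain I ≤
      (I.comap g.1.toFun).map g.1.domain.subtype := by
    refine Submodule.span_le.2 ?_
    rintro _ ⟨a, ha, b, hb, rfl⟩
    refine ⟨⟨a * b, mul_mem_right _ ha b⟩, ?_, rfl⟩
    change g.1 ⟨a * b, _⟩ ∈ I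
    rw [map_mul g a b ha]
    exact hI.mul_mem_left _ hb
  obtain ⟨y, hy, rfl⟩ := key hx
  exact hy

/-- For `f : I → R` and `g : J → R`, the composite `f ∘ g`, defined on the ideal `J I`. -/
def comp (f g : PartialHom R) : PartialHom R :=
  ⟨{ domain := mulIdeal g.1.domain f.1.domain
     toFun :=
      { toFun := fun x => f.1 ⟨g.1 ⟨x.1, mulIdeal_le_left _ _ x.2⟩, apply_mem g f.2 x.2⟩
        map_add' := fun x y => by
          rw [← f.1.map_add]
          congr 1
          exact Subtype.ext
            (g.1.map_add ⟨x.1, mulIdeal_le_left _ _ x.2⟩ ⟨y.1, mulIdeal_le_left _ _ y.2⟩)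
        map_smul' := fun c x => by
          rw [RingHom.id_apply, ← f.1.map_smul]
          congr 1
          exact Subtype.ext (g.1.map_smul c ⟨x.1, mulIdeal_le_left _ _ x.2⟩) } },
    g.2.mul f.2⟩

theorem comp_apply (f g : PartialHom R) (x : R) (hx : x ∈ (comp f g).1.domain) :
    (comp f g).1 ⟨x, hx⟩ =
      f.1 ⟨g.1 ⟨x, mulIdeal_le_left _ _ hx⟩, apply_mem g f.2 hx⟩ := rfl

theorem apply_congr (f : PartialHom R) {x y : R} (h : x = y) (hx : x ∈ f.1.domain)
    (hy : y ∈ f.1.domain) : f.1 ⟨x, hx⟩ = f.1 ⟨y, hy⟩ := by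
  subst h; rfl

theorem add_rel {f f' g g' : PartialHom R} (hf : Rel f f') (hg : Rel g g') :
    Rel (add f g) (add f' g') := by
  obtain ⟨J, hJ, h⟩ := hf
  obtain ⟨K, hK, h'⟩ := hg
  refine ⟨J ⊓ K, hJ.inf hK, fun x hx => ?_⟩
  obtain ⟨h1, h2, h3⟩ := h hx.1
  obtain ⟨h4, h5, h6⟩ := h' hx.2
  exact ⟨⟨h1, h4⟩, ⟨h2, h5⟩, congrArg₂ (· + ·) h3 h6⟩

theorem neg_rel {f f' : PartialHom R} (hf : Rel f f') : Rel (neg f) (neg f') := by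
  obtain ⟨J, hJ, h⟩ := hf
  refine ⟨J, hJ, fun x hx => ?_⟩
  obtain ⟨h1, h2, h3⟩ := h hx
  exact ⟨h1, h2, congrArg Neg.neg h3⟩

theorem comp_rel {f f' g g' : PartialHom R} (hf : Rel f f') (hg : Rel g g') :
    Rel (comp f g) (comp f' g') := by
  obtain ⟨J, hJ, h⟩ := hf
  obtain ⟨K, hK, h'⟩ := hg
  refine ⟨mulIdeal K J, hK.mul hJ, Submodule.span_le.2 ?_⟩
  rintro _ ⟨a, ha, b, hb, rfl⟩
  obtain ⟨h1, h2, _⟩ := h hb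
  obtain ⟨h4, h5, h6⟩ := h' ha
  have m1 : a * b ∈ mulIdeal g.1.domain f.1.domain :=
    Submodule.subset_span ⟨a, h4, b, h1, rfl⟩
  have m2 : a * b ∈ mulIdeal g'.1.domain f'.1.domain :=
    Submodule.subset_span ⟨a, h5, b, h2, rfl⟩
  refine ⟨m1, m2, ?_⟩
  refine (comp_apply f g _ m1).trans (Eq.trans ?_ (comp_apply f' g' _ m2).symm)
  have e1 := map_mul g a b h4 (mulIdeal_le_left _ _ m1)
  have e2 := map_mul g' a b h5 (mulIdeal_le_left _ _ m2)
  have hmem : g.1 ⟨a, h4⟩ * b ∈ J := hJ.mul_mem_left _ hb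
  obtain ⟨k1, k2, k3⟩ := h hmem
  rw [apply_congr f e1 _ k1, k3]
  exact apply_congr f' (by rw [e2, h6]) _ _

end PartialHom

end AmitsurMartindale

/-- The right Amitsur–Martindale ring of quotients `Q_r(R) = lim Hom(I_R, R_R)`, `I ∈ ℰ(R)`. -/
def RightQuotients (R : Type*) [Ring R] : Type _ :=
  Quotient (AmitsurMartindale.PartialHom.setoid R)

namespace RightQuotients

open AmitsurMartindale

variable {R : Type*} [Ring R]

/-- The class of a right module map `f : I_R → R_R`, `I ∈ ℰ(R)`. -/
def mk (f : PartialHom R) : RightQuotients R := Quotient.mk _ f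

theorem mk_eq_mk {f g : PartialHom R} : mk f = mk g ↔ PartialHom.Rel f g := Quotient.eq

theorem mk_eq_of_forall {f g : PartialHom R}
    (h : ∀ (x : R) (hf : x ∈ f.1.domain) (hg : x ∈ g.1.domain), f.1 ⟨x, hf⟩ = g.1 ⟨x, hg⟩) :
    mk f = mk g :=
  mk_eq_mk.2 (PartialHom.Rel.of_forall h)

instance : Zero (RightQuotients R) := ⟨mk (PartialHom.lmul 0)⟩

instance : One (RightQuotients R) := ⟨mk (PartialHom.lmul 1)⟩

instance : Add (RightQuotients R) :=
  ⟨Quotient.map₂ PartialHom.add fun _ _ h _ _ h' => PartialHom.add_rel h h'⟩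

instance : Neg (RightQuotients R) :=
  ⟨Quotient.map PartialHom.neg fun _ _ h => PartialHom.neg_rel h⟩

instance : Mul (RightQuotients R) :=
  ⟨Quotient.map₂ PartialHom.comp fun _ _ h _ _ h' => PartialHom.comp_rel h h'⟩

theorem zero_def : (0 : RightQuotients R) = mk (PartialHom.lmul 0) := rfl

theorem one_def : (1 : RightQuotients R) = mk (PartialHom.lmul 1) := rfl

theorem mk_add (f g : PartialHom R) : mk f + mk g = mk (PartialHom.add f g) := rfl

theorem neg_mk (f : PartialHom R) : -mk f = mk (PartialHom.neg f) := rfl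

theorem mk_mul (f g : PartialHom R) : mk f * mk g = mk (PartialHom.comp f g) := rfl

theorem ind {p : RightQuotients R → Prop} (h : ∀ f, p (mk f)) (q : RightQuotients R) : p q :=
  Quotient.ind h q

instance : Ring (RightQuotients R) where
  add_assoc := by
    refine ind fun f => ind fun g => ind fun k => ?_
    refine mk_eq_of_forall fun x h1 h2 => ?_
    simp only [PartialHom.add_apply, add_assoc]
  zero_add := by
    refine ind fun f => mk_eq_of_forall fun x h1 h2 => ?_
    rw [PartialHom.add_apply, PartialHom.lmul_apply, zero_mul, zero_add]
  add_zero := by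
    refine ind fun f => mk_eq_of_forall fun x h1 h2 => ?_
    rw [PartialHom.add_apply, PartialHom.lmul_apply, zero_mul, add_zero]
  add_comm := by
    refine ind fun f => ind fun g => mk_eq_of_forall fun x h1 h2 => ?_
    simp only [PartialHom.add_apply, add_comm]
  neg_add_cancel := by
    refine ind fun f => mk_eq_of_forall fun x h1 h2 => ?_
    rw [PartialHom.add_apply, PartialHom.lmul_apply, zero_mul, PartialHom.neg_apply, neg_add_cancel]
  mul_assoc := by
    refine ind fun f => ind fun g => ind fun k => ?_
    refine mk_eq_of_forall fun x h1 h2 => ?_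
    simp only [PartialHom.comp_apply]
  one_mul := by
    refine ind fun f => mk_eq_of_forall fun x h1 h2 => ?_
    rw [PartialHom.comp_apply, PartialHom.lmul_apply, one_mul]
  mul_one := by
    refine ind fun f => mk_eq_of_forall fun x h1 h2 => ?_
    rw [PartialHom.comp_apply]
    exact PartialHom.apply_congr f (one_mul x) _ _
  zero_mul := by
    refine ind fun f => mk_eq_of_forall fun x h1 h2 => ?_
    rw [PartialHom.comp_apply, PartialHom.lmul_apply, PartialHom.lmul_apply, zero_mul, zero_mul]
  mul_zero := by
    refine ind fun f => mk_eq_of_forall fun x h1 h2 => ?_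
    have h3 : (PartialHom.lmul (0 : R)).1 ⟨x, h2⟩ = 0 := zero_mul x
    rw [h3, PartialHom.comp_apply]
    exact (PartialHom.apply_congr f (zero_mul x) _ (Submodule.zero_mem _)).trans f.1.map_zero
  left_distrib := by
    refine ind fun f => ind fun g => ind fun k => ?_
    refine mk_eq_of_forall fun x h1 h2 => ?_
    rw [PartialHom.add_apply, PartialHom.comp_apply, PartialHom.comp_apply, PartialHom.comp_apply, ← f.1.map_add]
    exact PartialHom.apply_congr f (PartialHom.add_apply g k x _) _ _
  right_distrib := by
    refine ind fun f => ind fun g => ind fun k => ?_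
    refine mk_eq_of_forall fun x h1 h2 => ?_
    rw [PartialHom.add_apply, PartialHom.comp_apply, PartialHom.comp_apply, PartialHom.comp_apply, PartialHom.add_apply]
  nsmul := nsmulRec
  zsmul := zsmulRec

/-- The canonical embedding `R → Q_r(R)`, sending `r` to the class of left multiplication by `r`. -/
def ofRing : R →+* RightQuotients R where
  toFun r := mk (PartialHom.lmul r)
  map_zero' := rfl
  map_one' := rfl
  map_add' r s := mk_eq_of_forall fun x h1 h2 => by
    rw [PartialHom.add_apply, PartialHom.lmul_apply, PartialHom.lmul_apply, PartialHom.lmul_apply, add_mul]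
  map_mul' r s := mk_eq_of_forall fun x h1 h2 => by
    rw [PartialHom.comp_apply, PartialHom.lmul_apply, PartialHom.lmul_apply, PartialHom.lmul_apply, mul_assoc]

end RightQuotients

/-! ### Classical rings of quotients -/

/-- A ring homomorphism `φ : R → Q` exhibits `Q` as a classical (right) ring of quotients of `R`:
`φ` is injective, it sends every regular element (nonzerodivisor on both sides) to a unit, and
every element of `Q` has the form `φ(a) φ(s)⁻¹` with `s` regular. -/
structure IsClassicalRingOfQuotients {R Q : Type*} [Ring R] [Ring Q] (φ : R →+* Q) : Prop where
  injective : Function.Injective φ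
  isUnit_map : ∀ s ∈ nonZeroDivisors R, IsUnit (φ s)
  exists_fraction : ∀ q : Q, ∃ a : R, ∃ s ∈ nonZeroDivisors R, q * φ s = φ a

/-! ### The adjoint action -/

section AdjointAction

attribute [local instance 100] LieRing.ofAssociativeRing

variable {k L Q : Type*} [Field k] [LieRing L] [LieAlgebra k L] [Ring Q] [Algebra k Q]

/-- The adjoint action `U(L) → End_k(Q)` on a `k`-algebra `Q` that receives an algebra map `θ` from
`U(L)`: the algebra map extending `ad x (q) = θ(x) q - q θ(x)` for `x ∈ L`. -/
noncomputable def adAction (θ : UniversalEnvelopingAlgebra k L →ₐ[k] Q) :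
    UniversalEnvelopingAlgebra k L →ₐ[k] Module.End k Q :=
  UniversalEnvelopingAlgebra.lift k
    ((LieAlgebra.ad k Q).comp ((UniversalEnvelopingAlgebra.lift k).symm θ))

theorem adAction_ι (θ : UniversalEnvelopingAlgebra k L →ₐ[k] Q) (x : L) (q : Q) :
    adAction θ (UniversalEnvelopingAlgebra.ι k x) q =
      θ (UniversalEnvelopingAlgebra.ι k x) * q - q * θ (UniversalEnvelopingAlgebra.ι k x) := by
  rw [adAction, UniversalEnvelopingAlgebra.lift_ι_apply]
  rfl

/-- `q` is `ad L`-finite if the `k`-subspace `ad U(L)(q)` of `Q` is finite dimensional. -/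
def IsAdFinite (θ : UniversalEnvelopingAlgebra k L →ₐ[k] Q) (q : Q) : Prop :=
  FiniteDimensional k (LinearMap.range ((adAction θ).toLinearMap.flip q))

end AdjointAction

/-! ### Goldie's theorem for semiprime right noetherian rings -/

/-! The ring `R` is right noetherian, because products of generators commute up to lower order and
symbols of right ideals are ideals of a polynomial ring (`isNoetherian_of_commutators_mem_span`).
For semiprime `R`, Goldie's argument then puts a regular element in every essential right ideal
(`IsSemiprimeRing.exists_mem_nonZeroDivisors`). The right Ore condition follows, and with it a
classical ring of quotients.

An ideal `I` of the filter is essential as a right ideal, so it contains a regular `s`, and `f : I →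
R` is left multiplication by the unique element `f(s)s⁻¹` of `Q`. This embeds `Q_r(R)` in `Q`, with
image the set of `q` such that `qI ⊆ R` for some `I` in the filter.

Such `q` are exactly the ad-finite ones. If `qI ⊆ R`, choose a finite-dimensional ad-stable `V ⊆ I`
containing a regular `s`. Then `qV` lies in some piece `F m` of the filtration, and `{p | pV ⊆ F m}`
is ad-stable and embeds in `F m` by `p ↦ ps`. Conversely, if `q` lies in a finite-dimensional
ad-stable `A`, then `I = {r | Ar ⊆ R}` is a two-sided ideal, and it contains a common denominator of
`A`, so its left annihilator is zero. -/

/-- The ideal generated by `a` has square zero: the relation `x r y = 0` for all `r` spreads from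
`a` to that ideal, first in `x`, then in `y`. -/
theorem IsSemiprimeRing.eq_zero_of_mul_mul_self {R : Type*} [Ring R] (hR : IsSemiprimeRing R)
    {a : R} (h : ∀ r, a * r * a = 0) : a = 0 := by
  set I := TwoSidedIdeal.span ({a} : Set R)
  have h1 : ∀ x ∈ I, ∀ r, x * r * a = 0 := by
    let K : TwoSidedIdeal R := .mk' {x | ∀ r, x * r * a = 0} (by simp)
      (fun hx hy r => by rw [add_mul, add_mul, hx, hy, add_zero])
      (fun hx r => by rw [neg_mul, neg_mul, hx, neg_zero])
      (fun {x y} hy r => by rw [mul_assoc x, mul_assoc x, hy, mul_zero])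
      (fun {x y} hx r => by rw [mul_assoc x, hx])
    have : I ≤ K := TwoSidedIdeal.span_le.2 (by
      rintro _ rfl
      exact (TwoSidedIdeal.mem_mk' ..).2 h)
    exact fun x hx => (TwoSidedIdeal.mem_mk' ..).1 (this hx)
  have h2 : ∀ y ∈ I, ∀ x ∈ I, ∀ r, x * r * y = 0 := by
    let K : TwoSidedIdeal R := .mk' {y | ∀ x ∈ I, ∀ r, x * r * y = 0} (by simp)
      (fun hy hz x hx r => by rw [mul_add, hy x hx, hz x hx, add_zero])
      (fun hy x hx r => by rw [mul_neg, hy x hx, neg_zero])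
      (fun {z y} hy x hx r => by rw [← mul_assoc, mul_assoc x, hy x hx])
      (fun {y z} hy x hx r => by rw [← mul_assoc, hy x hx, zero_mul])
    have : I ≤ K := TwoSidedIdeal.span_le.2 (by
      rintro _ rfl
      exact (TwoSidedIdeal.mem_mk' ..).2 h1)
    exact fun x hx => (TwoSidedIdeal.mem_mk' ..).1 (this hx)
  have h3 : I = ⊥ := hR I fun x hx y hy => by simpa using h2 y hy x hx 1
  have h4 : a ∈ I := TwoSidedIdeal.subset_span rfl
  rwa [h3, TwoSidedIdeal.mem_bot] at h4

section Goldie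

open MulOpposite AmitsurMartindale

variable {R : Type*} [Ring R]

/-- The right annihilator `{r | a r = 0}` of an element, as a right ideal. -/
def rightAnnihilator (a : R) : Submodule Rᵐᵒᵖ R := LinearMap.ker (LinearMap.mulLeft Rᵐᵒᵖ a)

theorem mem_rightAnnihilator {a r : R} : r ∈ rightAnnihilator a ↔ a * r = 0 := Iff.rfl

theorem rightAnnihilator_le_mul (r a : R) : rightAnnihilator a ≤ rightAnnihilator (r * a) :=
  fun x hx => by
    rw [mem_rightAnnihilator] at *
    rw [mul_assoc, hx, mul_zero]

/-- A right ideal is essential if every nonzero element has a nonzero right multiple in it. -/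
def IsEssentialRight (E : Submodule Rᵐᵒᵖ R) : Prop :=
  ∀ x : R, x ≠ 0 → ∃ r : R, x * r ∈ E ∧ x * r ≠ 0

theorem IsEssentialRight.mono {E E' : Submodule Rᵐᵒᵖ R} (h : IsEssentialRight E) (hE : E ≤ E') :
    IsEssentialRight E' := fun x hx =>
  let ⟨r, h1, h2⟩ := h x hx
  ⟨r, hE h1, h2⟩

/-- In a semiprime ring, a two-sided ideal with zero left annihilator is an essential right
ideal. -/
theorem AmitsurMartindale.MemFilter.isEssentialRight {I : Submodule Rᵐᵒᵖ R} (hI : MemFilter I) :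
    IsEssentialRight I := by
  intro x hx
  by_contra! h
  refine hx (hI.eq_zero_of_mul_eq_zero x fun y hy => h y (hI.mul_mem_left x hy))

section Noetherian

variable [IsNoetherian Rᵐᵒᵖ R]

/-- Fitting's argument: the right annihilators of the powers of `x` stabilise, so a high power `y`
has `yR ∩ ann(y) = 0`. The exponent is positive so that `y` stays in every right ideal containing
`x`. -/
theorem exists_pow_succ_mul_eq_zero (x : R) :
    ∃ n : ℕ, ∀ r, x ^ (n + 1) * (x ^ (n + 1) * r) = 0 → x ^ (n + 1) * r = 0 := by
  obtain ⟨n, hn⟩ := monotone_stabilizes_iff_noetherian.2 ‹IsNoetherian Rᵐᵒᵖ R›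
    ⟨fun n => rightAnnihilator (x ^ n), fun m n h => by
      obtain ⟨k, rfl⟩ := Nat.exists_eq_add_of_le' h
      simpa [pow_add] using rightAnnihilator_le_mul (x ^ k) (x ^ m)⟩
  refine ⟨n, fun r hr => ?_⟩
  rw [← mul_assoc, ← pow_add, ← mem_rightAnnihilator] at hr
  have h1 : rightAnnihilator (x ^ n) = rightAnnihilator (x ^ (n + 1)) := hn _ (by lia)
  have h2 : rightAnnihilator (x ^ n) = rightAnnihilator (x ^ (n + 1 + (n + 1))) := hn _ (by lia)
  rwa [← h2, h1, mem_rightAnnihilator] at hr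

/-- Levitzki's theorem by Utumi's argument: take `x = ra ≠ 0` with maximal right annihilator. If `sx
≠ 0`, its last nonzero power has the same right annihilator as `x` and kills `sx`, so `xsx = 0`. -/
theorem IsSemiprimeRing.eq_zero_of_isNilpotent_mul_left (hR : IsSemiprimeRing R) {a : R}
    (h : ∀ r, IsNilpotent (r * a)) : a = 0 := by
  by_contra ha
  let T : Set (Submodule Rᵐᵒᵖ R) := {J | ∃ r, r * a ≠ 0 ∧ J = rightAnnihilator (r * a)}
  obtain ⟨_, ⟨r, hr, rfl⟩, hmax⟩ := set_has_maximal_iff_noetherian.2 ‹IsNoetherian Rᵐᵒᵖ R› T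
    ⟨rightAnnihilator (1 * a), 1, by simpa using ha, rfl⟩
  refine hr (hR.eq_zero_of_mul_mul_self fun s => ?_)
  set x := r * a with hx
  by_cases hy : s * x = 0
  · rw [mul_assoc, hy, mul_zero]
  have hnil : IsNilpotent (s * x) := by
    rw [hx, ← mul_assoc]
    exact h _
  have : Nontrivial R := ⟨⟨_, _, ha⟩⟩
  set n := nilpotencyClass (s * x) with hn
  have h2 : 1 < n := by
    by_contra! hlt
    have := pow_eq_zero_of_le hlt (pow_nilpotencyClass hnil)
    simp [hy] at this
  obtain ⟨m, hm⟩ : ∃ m, n = m + 2 := ⟨n - 2, by lia⟩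
  have h3 : (s * x) ^ (m + 1) ≠ 0 := by
    have := pow_pred_nilpotencyClass hnil
    rwa [← hn, hm] at this
  have h4 : (s * x) ^ (m + 1) * (s * x) = 0 := by
    have := pow_nilpotencyClass hnil
    rwa [← hn, hm, pow_succ] at this
  have h5 : (s * x) ^ (m + 1) = (s * x) ^ m * s * x := by rw [pow_succ, mul_assoc]
  have h6 : (s * x) ^ m * s * x = ((s * x) ^ m * s * r) * a := by rw [hx, ← mul_assoc _ r a]
  have h7 := hmax (rightAnnihilator ((s * x) ^ (m + 1)))
    ⟨(s * x) ^ m * s * r, by rwa [← h6, ← h5], by rw [← h6, ← h5]⟩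
  have h8 : rightAnnihilator x ≤ rightAnnihilator ((s * x) ^ (m + 1)) := by
    rw [h5]
    exact rightAnnihilator_le_mul _ _
  rw [mul_assoc, ← mem_rightAnnihilator, eq_of_le_of_not_lt h8 h7]
  exact h4

theorem IsSemiprimeRing.eq_zero_of_isNilpotent_mul_right (hR : IsSemiprimeRing R) {a : R}
    (h : ∀ r, IsNilpotent (a * r)) : a = 0 := by
  refine hR.eq_zero_of_isNilpotent_mul_left fun r => ?_
  obtain ⟨n, hn⟩ := h r
  refine ⟨n + 1, ?_⟩
  rw [pow_succ, ← mul_assoc, mul_pow_mul, hn, mul_zero, zero_mul]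

/-- A semiprime right noetherian ring is right nonsingular. -/
theorem IsSemiprimeRing.eq_zero_of_isEssentialRight (hR : IsSemiprimeRing R) {z : R}
    (hz : IsEssentialRight (rightAnnihilator z)) : z = 0 := by
  refine hR.eq_zero_of_isNilpotent_mul_left fun r => ?_
  have hy := hz.mono (rightAnnihilator_le_mul r z)
  set y := r * z
  obtain ⟨n, hn⟩ := exists_pow_succ_mul_eq_zero y
  refine ⟨n + 1, ?_⟩
  by_contra h0
  -- Essentiality gives a nonzero multiple of `y ^ (n + 1)` killed by `y`, which the choice of `n`
  -- forbids.
  obtain ⟨s, h1, h2⟩ := hy _ h0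
  refine h2 (hn s ?_)
  rw [mem_rightAnnihilator] at h1
  rw [pow_succ, mul_assoc, ← pow_succ, h1, mul_zero]

theorem IsSemiprimeRing.exists_mem_mul_self (hR : IsSemiprimeRing R) {J : Submodule Rᵐᵒᵖ R}
    (hJ : J ≠ ⊥) : ∃ a ∈ J, a ≠ 0 ∧ ∀ r, a * (a * r) = 0 → a * r = 0 := by
  obtain ⟨b, hb, hb0⟩ := J.ne_bot_iff.1 hJ
  obtain ⟨r, hr⟩ : ∃ r, ¬ IsNilpotent (b * r) := by
    by_contra! h
    exact hb0 (hR.eq_zero_of_isNilpotent_mul_right h)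
  obtain ⟨n, hn⟩ := exists_pow_succ_mul_eq_zero (b * r)
  refine ⟨_, ?_, fun h => hr ⟨_, h⟩, hn⟩
  rw [pow_succ']
  exact mul_mem_right J (mul_mem_right J hb r) _

/-- If `cR ∩ xR = 0`, then `(r, y) ↦ cr + y` embeds `R × xR` in `R`, and a noetherian module allows
this only for `xR = 0`. -/
theorem isEssentialRight_range_mulLeft {c : R} (hc : ∀ r, c * r = 0 → r = 0) :
    IsEssentialRight (LinearMap.range (LinearMap.mulLeft Rᵐᵒᵖ c)) := by
  intro x hx
  by_contra! h
  let f : (R × Submodule.span Rᵐᵒᵖ {x}) →ₗ[Rᵐᵒᵖ] R :=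
    (LinearMap.mulLeft Rᵐᵒᵖ c).coprod (Submodule.subtype _)
  have hf : Function.Injective f := by
    rw [injective_iff_map_eq_zero]
    rintro ⟨r, y, hy⟩ h0
    obtain ⟨s, rfl⟩ := Submodule.mem_span_singleton.1 hy
    have h1 : c * r + x * s.unop = 0 := h0
    have h2 : x * s.unop = 0 := h _ ⟨-r, by simpa using (eq_neg_of_add_eq_zero_right h1).symm⟩
    rw [h2, add_zero] at h1
    exact Prod.ext (hc r h1) (Subtype.ext h2)
  have := IsNoetherian.subsingleton_of_prod_injective f hf
  refine hx ?_
  simpa using Subsingleton.elim (⟨x, Submodule.mem_span_singleton_self x⟩ : Submodule.span Rᵐᵒᵖ {x}) 0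

/-- If `xc = 0`, the right annihilator of `x` contains the essential right ideal `cR`, so `x = 0` by
nonsingularity. -/
theorem IsSemiprimeRing.mem_nonZeroDivisors (hR : IsSemiprimeRing R) {c : R}
    (hc : ∀ r, c * r = 0 → r = 0) : c ∈ nonZeroDivisors R := by
  refine mem_nonZeroDivisors_iff.2 ⟨hc, fun x hx => hR.eq_zero_of_isEssentialRight
    ((isEssentialRight_range_mulLeft hc).mono ?_)⟩
  rintro _ ⟨r, rfl⟩
  rw [mem_rightAnnihilator, LinearMap.mulLeft_apply, ← mul_assoc, hx, zero_mul]

/-- **Goldie**: an essential right ideal of a semiprime right noetherian ring contains a regular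
element. -/
theorem IsSemiprimeRing.exists_mem_nonZeroDivisors (hR : IsSemiprimeRing R)
    {E : Submodule Rᵐᵒᵖ R} (hE : IsEssentialRight E) : ∃ c ∈ E, c ∈ nonZeroDivisors R := by
  -- The right ideal `S` measures progress: it meets the annihilator of `c` trivially. If a maximal
  -- `S` came with a `c` that is not left cancellable, some nonzero `a ∈ E ∩ ann(c)` would let `c +
  -- a` serve for the larger `S + aR`.
  let T : Set (Submodule Rᵐᵒᵖ R) := {S | ∃ c ∈ E, (∀ r, c * (c * r) = 0 → c * r = 0) ∧
    ∀ s ∈ S, c * s = 0 → s = 0}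
  obtain ⟨S, ⟨c, hcE, hc, hS⟩, hmax⟩ :=
    set_has_maximal_iff_noetherian.2 ‹IsNoetherian Rᵐᵒᵖ R› T ⟨⊥, 0, by simp⟩
  refine ⟨c, hcE, hR.mem_nonZeroDivisors fun x hx => ?_⟩
  by_contra hx0
  obtain ⟨y, hy1, hy2⟩ := hE x hx0
  have hJ : E ⊓ rightAnnihilator c ≠ ⊥ := (Submodule.ne_bot_iff _).2
    ⟨x * y, ⟨hy1, mul_mem_right _ (mem_rightAnnihilator.2 hx) y⟩, hy2⟩
  obtain ⟨a, ⟨haE, hca⟩, ha0, ha⟩ := hR.exists_mem_mul_self hJ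
  replace hca : c * a = 0 := hca
  have key : ∀ r, (c + a) * r = 0 → c * r = 0 ∧ a * r = 0 := by
    intro r hr
    -- Multiplying by `c` removes `a`, since `ca = 0`.
    have h1 : c * r = 0 := hc r (by
      have := congrArg (c * ·) hr
      simpa [add_mul, mul_add, ← mul_assoc c a, hca] using this)
    rw [add_mul, h1, zero_add] at hr
    exact ⟨h1, hr⟩
  have hlt : S < S ⊔ Submodule.span Rᵐᵒᵖ {a} := by
    refine left_lt_sup.2 fun hle => ha0 (hS a (hle (Submodule.mem_span_singleton_self a)) hca)
  refine hmax _ ⟨c + a, E.add_mem hcE haE, fun r hr => ?_, fun s hs h0 => ?_⟩ hlt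
  · obtain ⟨h1, h2⟩ := key _ hr
    have h3 : c * r = 0 := hc r (by
      simpa [add_mul, mul_add, ← mul_assoc c a, hca] using h1)
    have h4 : a * r = 0 := ha r (by simpa [add_mul, h3] using h2)
    rw [add_mul, h3, h4, add_zero]
  · obtain ⟨h1, h2⟩ := key _ h0
    obtain ⟨t, ht, w, hw, rfl⟩ := Submodule.mem_sup.1 hs
    obtain ⟨r, rfl⟩ := Submodule.mem_span_singleton.1 hw
    have h3 : r • a = a * r.unop := rfl
    rw [h3] at h1 h2 ⊢
    have h4 : t = 0 := hS t ht (by simpa [mul_add, ← mul_assoc c a, hca] using h1)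
    rw [h4, zero_add] at h2 ⊢
    exact ha _ h2

/-- The right Ore condition for the regular elements of a semiprime right noetherian ring. -/
theorem IsSemiprimeRing.exists_ore (hR : IsSemiprimeRing R) (a : R) {s : R}
    (hs : s ∈ nonZeroDivisors R) : ∃ b : R, ∃ t ∈ nonZeroDivisors R, a * t = s * b := by
  have hE := isEssentialRight_range_mulLeft (mem_nonZeroDivisors_iff.1 hs).1
  have hE' : IsEssentialRight
      ((LinearMap.range (LinearMap.mulLeft Rᵐᵒᵖ s)).comap (LinearMap.mulLeft Rᵐᵒᵖ a)) := by
    intro x hx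
    by_cases h : a * x = 0
    · exact ⟨1, by simp [h], by simpa using hx⟩
    · obtain ⟨r, h1, h2⟩ := hE _ h
      refine ⟨r, ?_, fun h0 => h2 (by rw [mul_assoc, h0, mul_zero])⟩
      rwa [mul_assoc] at h1
  obtain ⟨t, ⟨b, hb⟩, ht'⟩ := hR.exists_mem_nonZeroDivisors hE'
  exact ⟨b, t, ht', hb.symm⟩

end Noetherian

end Goldie

/-! ### Almost commutative algebras are noetherian -/

section AlmostCommutative

open MulOpposite MvPolynomial

theorem MvPolynomial.homogeneousComponent_succ_X_mul {k ι : Type*} [CommSemiring k] (i : ι)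
    (p : MvPolynomial ι k) (n : ℕ) :
    homogeneousComponent (n + 1) (X i * p) = X i * homogeneousComponent n p := by
  classical
  ext m
  rw [coeff_homogeneousComponent, coeff_X_mul', coeff_X_mul', coeff_homogeneousComponent]
  by_cases hi : i ∈ m.support
  · have h1 : Finsupp.single i 1 + (m - Finsupp.single i 1) = m :=
      add_tsub_cancel_of_le (by
        rw [Finsupp.single_le_iff]
        exact Nat.one_le_iff_ne_zero.2 (Finsupp.mem_support_iff.1 hi))
    have h2 : m.degree = (m - Finsupp.single i 1).degree + 1 := by
      conv_lhs => rw [← h1, map_add, Finsupp.degree_single, add_comm]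
    simp [hi, h2]
  · simp [hi]

variable {k : Type*} [Field k] {R : Type*} [Ring R] [Algebra k R] {ι : Type*}

/-- The span of `1` and the elements `x i`. -/
def unitSpan (k : Type*) [Field k] {R : Type*} [Ring R] [Algebra k R] {ι : Type*} (x : ι → R) :
    Submodule k R := 1 ⊔ Submodule.span k (Set.range x)

theorem one_le_unitSpan (x : ι → R) : 1 ≤ unitSpan k x := le_sup_left

theorem mem_unitSpan (x : ι → R) (i : ι) : x i ∈ unitSpan k x :=
  (le_sup_right : _ ≤ unitSpan k x) (Submodule.subset_span ⟨i, rfl⟩)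

/-- The standard filtration shifted by one, starting with `0`. -/
def shiftedFiltration (k : Type*) [Field k] {R : Type*} [Ring R] [Algebra k R] {ι : Type*}
    (x : ι → R) : ℕ → Submodule k R
  | 0 => ⊥
  | n + 1 => unitSpan k x ^ n

theorem mul_mem_shiftedFiltration {x : ι → R} {n : ℕ} {a b : R} (ha : a ∈ shiftedFiltration k x n)
    (hb : b ∈ unitSpan k x) : a * b ∈ shiftedFiltration k x (n + 1) := by
  match n with
  | 0 =>
    rw [show a = 0 from ha, zero_mul]
    exact zero_mem _
  | n + 1 =>
    change _ ∈ unitSpan k x ^ (n + 1)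
    rw [pow_succ]
    exact Submodule.mul_mem_mul ha hb

theorem mul_mem_shiftedFiltration' {x : ι → R} {n : ℕ} {a b : R}
    (ha : a ∈ shiftedFiltration k x n) (hb : b ∈ unitSpan k x) :
    b * a ∈ shiftedFiltration k x (n + 1) := by
  match n with
  | 0 =>
    rw [show a = 0 from ha, mul_zero]
    exact zero_mem _
  | n + 1 =>
    change _ ∈ unitSpan k x ^ (n + 1)
    rw [pow_succ']
    exact Submodule.mul_mem_mul hb ha

theorem prod_mem_unitSpan_pow (x : ι → R) (l : List ι) :
    (l.map x).prod ∈ unitSpan k x ^ l.length := by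
  induction l with
  | nil => exact Submodule.one_le.1 le_rfl
  | cons i l ih =>
    rw [List.map_cons, List.prod_cons, List.length_cons, pow_succ']
    exact Submodule.mul_mem_mul (mem_unitSpan x i) ih

/-- Swapping two neighbours changes a word by a commutator, which is linear in the generators, so
one degree is lost. -/
theorem prod_sub_prod_mem_of_perm {x : ι → R}
    (hx : ∀ i j, x i * x j - x j * x i ∈ Submodule.span k (Set.range x)) {l l' : List ι}
    (h : l.Perm l') : (l.map x).prod - (l'.map x).prod ∈ shiftedFiltration k x l.length := by
  induction h with
  | nil => simp
  | cons i _ ih =>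
    rw [List.map_cons, List.map_cons, List.prod_cons, List.prod_cons, ← mul_sub]
    exact mul_mem_shiftedFiltration' ih (mem_unitSpan x i)
  | swap i j l =>
    simp only [List.map_cons, List.prod_cons, List.length_cons]
    rw [← mul_assoc, ← mul_assoc, ← sub_mul]
    exact mul_mem_shiftedFiltration' (n := l.length + 1) (prod_mem_unitSpan_pow x l)
      ((le_sup_right : _ ≤ unitSpan k x) (hx _ _))
  | trans h1 _ ih1 ih2 =>
    rw [← h1.length_eq] at ih2
    simpa using add_mem ih1 ih2

/-- The linear map sending a monomial to a product of the `x i`, taken in some order. -/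
noncomputable def symbolMap (k : Type*) [Field k] {R : Type*} [Ring R] [Algebra k R] {ι : Type*}
    (x : ι → R) : MvPolynomial ι k →ₗ[k] R :=
  (basisMonomials ι k).constr k fun m => ((Finsupp.toMultiset m).toList.map x).prod

theorem symbolMap_monomial (x : ι → R) (m : ι →₀ ℕ) (c : k) :
    symbolMap k x (monomial m c) = c • ((Finsupp.toMultiset m).toList.map x).prod := by
  have h : monomial m c = c • basisMonomials ι k m := by simp [smul_monomial]
  rw [h, map_smul, symbolMap, Module.Basis.constr_basis]

/-- Modulo lower order, multiplication by `X i` turns into right multiplication by `x i`; the right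
side is chosen to suit right ideals. -/
theorem symbolMap_X_mul_sub {x : ι → R}
    (hx : ∀ i j, x i * x j - x j * x i ∈ Submodule.span k (Set.range x)) (i : ι) {n : ℕ}
    {p : MvPolynomial ι k} (hp : p.IsHomogeneous n) :
    symbolMap k x (X i * p) - symbolMap k x p * x i ∈ unitSpan k x ^ n := by
  rw [p.as_sum, Finset.mul_sum, map_sum, map_sum, Finset.sum_mul,
    ← Finset.sum_sub_distrib]
  refine sum_mem fun m hm => ?_
  have hm' : m.degree = n := by
    rw [Finsupp.degree_eq_weight_one]
    exact hp (mem_support_iff.1 hm)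
  rw [X, monomial_mul, one_mul, symbolMap_monomial, symbolMap_monomial, smul_mul_assoc, ← smul_sub]
  refine Submodule.smul_mem _ _ ?_
  have hperm : (Finsupp.toMultiset (Finsupp.single i 1 + m)).toList.Perm
      ((Finsupp.toMultiset m).toList ++ [i]) := by
    rw [← Multiset.coe_eq_coe, ← Multiset.coe_add, Multiset.coe_toList, Multiset.coe_toList,
      map_add, add_comm, Finsupp.toMultiset_single, one_smul, Multiset.coe_singleton]
  have := prod_sub_prod_mem_of_perm hx hperm
  rw [hperm.length_eq, List.length_append, Multiset.length_toList, Finsupp.card_toMultiset,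
    List.map_append, List.prod_append] at this
  have hs : (m.sum fun _ => id) = n := by
    rw [← hm']; rfl
  rw [hs] at this
  simpa [shiftedFiltration] using this

theorem exists_isHomogeneous_sub_mem {x : ι → R}
    (hx : ∀ i j, x i * x j - x j * x i ∈ Submodule.span k (Set.range x)) (n : ℕ) {y : R}
    (hy : y ∈ unitSpan k x ^ n) :
    ∃ p : MvPolynomial ι k, p.IsHomogeneous n ∧
      y - symbolMap k x p ∈ shiftedFiltration k x n := by
  induction n generalizing y with
  | zero =>
    rw [pow_zero] at hy
    obtain ⟨c, rfl⟩ := Submodule.mem_one.1 hy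
    refine ⟨monomial 0 c, isHomogeneous_C _ _, ?_⟩
    rw [symbolMap_monomial, map_zero, Multiset.toList_zero, List.map_nil, List.prod_nil,
      Algebra.algebraMap_eq_smul_one, sub_self]
    exact zero_mem _
  | succ n ih =>
    rw [pow_succ] at hy
    have hadd : ∀ y z : R, (∃ p : MvPolynomial ι k, p.IsHomogeneous (n + 1) ∧
        y - symbolMap k x p ∈ shiftedFiltration k x (n + 1)) →
        (∃ p : MvPolynomial ι k, p.IsHomogeneous (n + 1) ∧
        z - symbolMap k x p ∈ shiftedFiltration k x (n + 1)) →
        ∃ p : MvPolynomial ι k, p.IsHomogeneous (n + 1) ∧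
        y + z - symbolMap k x p ∈ shiftedFiltration k x (n + 1) := by
      rintro y z ⟨p, hp, hp'⟩ ⟨q, hq, hq'⟩
      refine ⟨p + q, hp.add hq, ?_⟩
      rw [map_add, add_sub_add_comm]
      exact add_mem hp' hq'
    refine Submodule.mul_induction_on hy (fun a ha w hw => ?_) hadd
    obtain ⟨c, hc, v, hv, rfl⟩ := Submodule.mem_sup.1 hw
    obtain ⟨c, rfl⟩ := Submodule.mem_one.1 hc
    rw [mul_add]
    refine hadd _ _ ⟨0, isHomogeneous_zero _ _ _, ?_⟩ ?_
    · rw [map_zero, sub_zero, ← Algebra.commutes, ← Algebra.smul_def]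
      exact Submodule.smul_mem _ _ ha
    clear hw hc
    induction hv using Submodule.span_induction with
    | mem v hv =>
      obtain ⟨i, rfl⟩ := hv
      obtain ⟨p, hp, hp'⟩ := ih ha
      refine ⟨X i * p, by simpa [add_comm] using (isHomogeneous_X k i).mul hp, ?_⟩
      have h1 := mul_mem_shiftedFiltration hp' (mem_unitSpan x i)
      have h2 : symbolMap k x (X i * p) - symbolMap k x p * x i ∈ shiftedFiltration k x (n + 1) :=
        symbolMap_X_mul_sub hx i hp
      have h3 := sub_mem h1 h2
      rwa [sub_mul, sub_sub_sub_cancel_right] at h3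
    | zero => exact ⟨0, isHomogeneous_zero _ _ _, by simp⟩
    | add u v _ _ hu hv => rw [mul_add]; exact hadd _ _ hu hv
    | smul c v _ hv =>
      obtain ⟨p, hp, hp'⟩ := hv
      refine ⟨c • p, (homogeneousSubmodule ι k (n + 1)).smul_mem c hp, ?_⟩
      rw [map_smul, mul_smul_comm, ← smul_sub]
      exact Submodule.smul_mem _ _ hp'

/-- The ideal of symbols of a right ideal. -/
noncomputable def symbolIdeal {x : ι → R}
    (hx : ∀ i j, x i * x j - x j * x i ∈ Submodule.span k (Set.range x))
    (I : Submodule Rᵐᵒᵖ R) : Ideal (MvPolynomial ι k) where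
  carrier := {p | ∀ n, symbolMap k x (homogeneousComponent n p) ∈
    I.restrictScalars k ⊔ shiftedFiltration k x n}
  zero_mem' n := by simp
  add_mem' hp hq n := by
    rw [map_add, map_add]
    exact add_mem (hp n) (hq n)
  smul_mem' q p hp := by
    rw [smul_eq_mul]
    induction q using MvPolynomial.induction_on generalizing p with
    | C c =>
      intro n
      rw [← smul_eq_C_mul, map_smul, map_smul]
      exact Submodule.smul_mem _ _ (hp n)
    | add q q' hq hq' =>
      intro n
      rw [add_mul, map_add, map_add]
      exact add_mem (hq p hp n) (hq' p hp n)
    | mul_X q i hq =>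
      rw [mul_assoc]
      refine hq _ fun n => ?_
      match n with
      | 0 =>
        classical
        rw [homogeneousComponent_zero, coeff_X_mul', if_neg (by simp), C_0, map_zero]
        exact zero_mem _
      | n + 1 =>
        rw [homogeneousComponent_succ_X_mul]
        obtain ⟨a, ha, g, hg, hag⟩ := Submodule.mem_sup.1 (hp n)
        have h1 : symbolMap k x (X i * homogeneousComponent n p) -
            symbolMap k x (homogeneousComponent n p) * x i ∈ shiftedFiltration k x (n + 1) :=
          symbolMap_X_mul_sub hx i (homogeneousComponent_isHomogeneous n p)
        have h2 := mul_mem_shiftedFiltration hg (mem_unitSpan x i)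
        refine Submodule.mem_sup.2 ⟨a * x i, AmitsurMartindale.mul_mem_right I ha _, _,
          add_mem h1 h2, ?_⟩
        rw [← hag, add_mul]
        abel

theorem symbolIdeal_mono {x : ι → R}
    (hx : ∀ i j, x i * x j - x j * x i ∈ Submodule.span k (Set.range x)) :
    Monotone (symbolIdeal hx) := fun I J h _ hp n =>
  sup_le_sup_right (show I.restrictScalars k ≤ J.restrictScalars k from h) _ (hp n)

/-- Induction on filtration degree: an element of `J` has the same leading symbol as some `a ∈ I`,
and subtracting `a` lowers the degree. -/
theorem eq_of_symbolIdeal_le {x : ι → R}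
    (hx : ∀ i j, x i * x j - x j * x i ∈ Submodule.span k (Set.range x))
    (hgen : ∀ r : R, ∃ n, r ∈ unitSpan k x ^ n) {I J : Submodule Rᵐᵒᵖ R} (hIJ : I ≤ J)
    (h : symbolIdeal hx J ≤ symbolIdeal hx I) : J ≤ I := by
  have key : ∀ n, ∀ y ∈ J, y ∈ shiftedFiltration k x n → y ∈ I := by
    intro n
    induction n with
    | zero =>
      intro y _ hy
      rw [show y = 0 from hy]
      exact zero_mem _
    | succ n ih =>
      intro y hyJ hy
      obtain ⟨p, hp, hp'⟩ := exists_isHomogeneous_sub_mem hx n hy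
      have hpJ : p ∈ symbolIdeal hx J := by
        intro m
        rw [homogeneousComponent_of_mem hp]
        split_ifs with hm
        · subst hm
          exact Submodule.mem_sup.2 ⟨y, hyJ, _, neg_mem hp', by abel⟩
        · simp
      have hpI := h hpJ n
      rw [homogeneousComponent_eq_self hp] at hpI
      obtain ⟨a, ha, g, hg, hag⟩ := Submodule.mem_sup.1 hpI
      have h1 : y - a ∈ I := by
        refine ih _ (sub_mem hyJ (hIJ ha)) ?_
        have := add_mem hp' hg
        rwa [← hag, sub_add_eq_sub_sub, sub_add_cancel] at this
      simpa using add_mem h1 ha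
  intro y hy
  obtain ⟨n, hn⟩ := hgen y
  exact key (n + 1) y hy hn

/-- A `k`-algebra generated by finitely many elements whose commutators are linear combinations of
these elements is right noetherian. -/
theorem isNoetherian_of_commutators_mem_span [Finite ι] {x : ι → R}
    (hx : ∀ i j, x i * x j - x j * x i ∈ Submodule.span k (Set.range x))
    (hgen : ∀ r : R, ∃ n, r ∈ unitSpan k x ^ n) : IsNoetherian Rᵐᵒᵖ R := by
  rw [isNoetherian_iff']
  -- Strict monotonicity carries the ascending chain condition back from the polynomial ring, where
  -- it is Hilbert's basis theorem.
  have hs : StrictMono (symbolIdeal hx) := fun I J h =>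
    (symbolIdeal_mono hx h.le).lt_of_not_ge fun hle =>
      h.not_ge (eq_of_symbolIdeal_le hx hgen h.le hle)
  exact hs.wellFoundedGT

end AlmostCommutative

/-! ### Existence of the classical ring of quotients -/

section OreLocalization

open MulOpposite

theorem op_mem_nonZeroDivisors {R : Type*} [Ring R] {s : R} :
    op s ∈ nonZeroDivisors Rᵐᵒᵖ ↔ s ∈ nonZeroDivisors R := by
  simp only [mem_nonZeroDivisors_iff, MulOpposite.forall, ← op_mul, op_eq_zero_iff]
  exact and_comm

/-- A right Ore ring has a classical ring of quotients. -/
theorem exists_isClassicalRingOfQuotients (k : Type*) [Field k] {R : Type u} [Ring R] [Algebra k R]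
    (hore : ∀ a : R, ∀ s ∈ nonZeroDivisors R, ∃ b : R, ∃ t ∈ nonZeroDivisors R, a * t = s * b) :
    ∃ (Q : Type u) (_ : Ring Q) (_ : Algebra k Q) (φ : R →ₐ[k] Q),
      IsClassicalRingOfQuotients (φ : R →+* Q) := by
  choose num den hden heq using hore
  -- `OreLocalization` forms left fractions, so the opposite ring is localised and the result is
  -- turned back by a second `ᵐᵒᵖ`.
  let _ : OreLocalization.OreSet (nonZeroDivisors Rᵐᵒᵖ) :=
    { ore_right_cancel := fun r₁ r₂ s h => ⟨1, by
        have h0 : (r₁ - r₂) * s = 0 := by rw [sub_mul, h, sub_self]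
        rw [sub_eq_zero.1 ((mem_nonZeroDivisors_iff.1 s.2).2 _ h0)]⟩
      oreNum := fun r s => op (num r.unop s.1.unop (op_mem_nonZeroDivisors.1 s.2))
      oreDenom := fun r s => ⟨op (den r.unop s.1.unop (op_mem_nonZeroDivisors.1 s.2)),
        op_mem_nonZeroDivisors.2 (hden _ _ _)⟩
      ore_eq := fun r s => congrArg op (heq r.unop s.1.unop (op_mem_nonZeroDivisors.1 s.2)) }
  let j : Rᵐᵒᵖ →+* OreLocalization (nonZeroDivisors Rᵐᵒᵖ) Rᵐᵒᵖ := OreLocalization.numeratorRingHom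
  let φ : R →ₐ[k] (OreLocalization (nonZeroDivisors Rᵐᵒᵖ) Rᵐᵒᵖ)ᵐᵒᵖ :=
    { toFun := fun r => op (j (op r))
      map_one' := by simp
      map_mul' := fun a b => by rw [op_mul, map_mul, op_mul]
      map_zero' := by simp
      map_add' := fun a b => by rw [op_add, map_add, op_add]
      commutes' := fun c => rfl }
  refine ⟨_, inferInstance, inferInstance, φ, ?_, ?_, ?_⟩
  · intro a b hab
    have h1 : j (op a) = j (op b) := op_injective hab
    exact op_injective (OreLocalization.numeratorHom_inj (S := nonZeroDivisors Rᵐᵒᵖ)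
      (fun x hx => hx.1) h1)
  · intro s hs
    have := OreLocalization.numerator_isUnit
      (⟨op s, op_mem_nonZeroDivisors.2 hs⟩ : nonZeroDivisors Rᵐᵒᵖ)
    exact this.op
  · intro q
    induction q using MulOpposite.rec' with | _ q
    induction q with | _ r s
    refine ⟨r.unop, s.1.unop, op_mem_nonZeroDivisors.1 s.2, congrArg op ?_⟩
    exact OreLocalization.mul_cancel (s := s) (t := 1)

end OreLocalization

/-! ### The embedding of the Amitsur–Martindale ring into the classical ring of quotients -/

section Embedding

open MulOpposite AmitsurMartindale

variable {R Q : Type*} [Ring R] [Ring Q]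

/-- `q` represents `f` if `q φ(x) = φ(f x)` for all `x` in the domain of `f`. -/
def AmitsurMartindale.PartialHom.IsRepresentedBy (φ : R →+* Q) (f : PartialHom R) (q : Q) : Prop :=
  ∀ (x : R) (hx : x ∈ f.1.domain), q * φ x = φ (f.1 ⟨x, hx⟩)

namespace AmitsurMartindale.PartialHom.IsRepresentedBy

variable {φ : R →+* Q} {f g : PartialHom R} {p q : Q}

theorem lmul (φ : R →+* Q) (r : R) : (PartialHom.lmul r).IsRepresentedBy φ (φ r) :=
  fun x hx => by rw [lmul_apply, _root_.map_mul]

theorem add (hf : f.IsRepresentedBy φ p) (hg : g.IsRepresentedBy φ q) :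
    (PartialHom.add f g).IsRepresentedBy φ (p + q) := fun x hx => by
  rw [add_apply, map_add, add_mul, hf x hx.1, hg x hx.2]

theorem comp (hf : f.IsRepresentedBy φ p) (hg : g.IsRepresentedBy φ q) :
    (PartialHom.comp f g).IsRepresentedBy φ (p * q) := fun x hx => by
  rw [comp_apply, mul_assoc, hg x (mulIdeal_le_left _ _ hx), hf]

theorem rel (hφ : Function.Injective φ) (hf : f.IsRepresentedBy φ q)
    (hg : g.IsRepresentedBy φ q) : Rel f g :=
  Rel.of_forall fun x hx hx' => hφ (by rw [← hf, ← hg])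

variable [IsNoetherian Rᵐᵒᵖ R] (hR : IsSemiprimeRing R) (hφ : IsClassicalRingOfQuotients φ)
include hR hφ

theorem unique (hf : f.IsRepresentedBy φ p) (hg : g.IsRepresentedBy φ q) (h : Rel f g) :
    p = q := by
  obtain ⟨J, hJ, hfg⟩ := h
  obtain ⟨s, hsJ, hs⟩ := hR.exists_mem_nonZeroDivisors hJ.isEssentialRight
  obtain ⟨h1, h2, h3⟩ := hfg hsJ
  exact (hφ.isUnit_map s hs).mul_right_cancel (by rw [hf s h1, hg s h2, h3])

omit hφ in
theorem exists_of_isClassicalRingOfQuotients (hφ : IsClassicalRingOfQuotients φ)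
    (f : PartialHom R) : ∃ q, f.IsRepresentedBy φ q := by
  obtain ⟨s, hsI, hs⟩ := hR.exists_mem_nonZeroDivisors f.2.isEssentialRight
  obtain ⟨u, hu⟩ := hφ.isUnit_map s hs
  refine ⟨φ (f.1 ⟨s, hsI⟩) * ↑u⁻¹, fun x hx => ?_⟩
  -- With `xt = sb`, both `f(x)t` and `f(s)s⁻¹xt` equal `f(s)b`; then `t` is cancelled.
  obtain ⟨b, t, ht, hxt⟩ := hR.exists_ore x hs
  refine (hφ.isUnit_map t ht).mul_right_cancel ?_
  have h1 : f.1 ⟨s * b, mul_mem_right _ hsI b⟩ = f.1 ⟨x * t, mul_mem_right _ hx t⟩ :=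
    apply_congr f hxt.symm _ _
  rw [map_mul f s b hsI, map_mul f x t hx] at h1
  rw [← _root_.map_mul, ← h1, mul_assoc, ← _root_.map_mul, hxt, _root_.map_mul φ s b, ← hu,
    mul_assoc, Units.inv_mul_cancel_left, _root_.map_mul]

end AmitsurMartindale.PartialHom.IsRepresentedBy

open PartialHom in
theorem RightQuotients.exists_ringHom [IsNoetherian Rᵐᵒᵖ R] (hR : IsSemiprimeRing R)
    {φ : R →+* Q} (hφ : IsClassicalRingOfQuotients φ) :
    ∃ ψ : RightQuotients R →+* Q,
      ∀ (f : PartialHom R) (q : Q), ψ (mk f) = q ↔ f.IsRepresentedBy φ q := by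
  choose F hF using IsRepresentedBy.exists_of_isClassicalRingOfQuotients hR hφ
  have huniq : ∀ (f : PartialHom R) q, f.IsRepresentedBy φ q → F f = q := fun f q h =>
    (hF f).unique hR hφ h (Setoid.refl f)
  let ψ : RightQuotients R → Q :=
    Quotient.lift F fun f g h => (hF f).unique hR hφ (hF g) h
  refine ⟨{ toFun := ψ
            map_one' := huniq _ _ (by simpa using IsRepresentedBy.lmul φ 1)
            map_zero' := huniq _ _ (by simpa using IsRepresentedBy.lmul φ 0)
            map_mul' := ind fun f => ind fun g => huniq _ _ ((hF f).comp (hF g))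
            map_add' := ind fun f => ind fun g => huniq _ _ ((hF f).add (hF g)) },
    fun f q => ⟨?_, huniq f q⟩⟩
  rintro rfl
  exact hF f

end Embedding

/-! ### Ad-finite elements -/

section AdFinite

attribute [local instance 100] LieRing.ofAssociativeRing

variable {k L : Type*} [Field k] [LieRing L] [LieAlgebra k L]

open UniversalEnvelopingAlgebra in
theorem UniversalEnvelopingAlgebra.map_mem_subalgebra {A : Type*} [Ring A] [Algebra k A]
    (θ : UniversalEnvelopingAlgebra k L →ₐ[k] A) (S : Subalgebra k A) (h : ∀ x, θ (ι k x) ∈ S)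
    (u : UniversalEnvelopingAlgebra k L) : θ u ∈ S := by
  obtain ⟨t, rfl⟩ := RingCon.mkₐ_surjective (α := k) (ringCon k L) u
  change θ (mkAlgHom k L t) ∈ S
  induction t using TensorAlgebra.induction with
  | algebraMap r =>
    rw [AlgHom.commutes, AlgHom.commutes]
    exact S.algebraMap_mem r
  | ι x => simpa using h x
  | mul a b ha hb =>
    rw [map_mul, map_mul]
    exact S.mul_mem ha hb
  | add a b ha hb =>
    rw [map_add, map_add]
    exact S.add_mem ha hb

variable {Q : Type*} [Ring Q] [Algebra k Q] {θ : UniversalEnvelopingAlgebra k L →ₐ[k] Q}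

theorem isAdFinite_of_mem {A : Submodule k Q} [FiniteDimensional k A]
    (hA : ∀ (x : L), ∀ a ∈ A, θ (UniversalEnvelopingAlgebra.ι k x) * a -
      a * θ (UniversalEnvelopingAlgebra.ι k x) ∈ A) {q : Q} (hq : q ∈ A) : IsAdFinite θ q := by
  let S : Subalgebra k (Module.End k Q) :=
    { carrier := {e | ∀ a ∈ A, e a ∈ A}
      mul_mem' := fun h h' a ha => h _ (h' a ha)
      add_mem' := fun h h' a ha => A.add_mem (h a ha) (h' a ha)
      algebraMap_mem' := fun c a ha => A.smul_mem c ha }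
  refine Submodule.finiteDimensional_of_le (S₂ := A) ?_
  rintro _ ⟨u, rfl⟩
  refine UniversalEnvelopingAlgebra.map_mem_subalgebra (adAction θ) S (fun x a ha => ?_) u q hq
  rw [adAction_ι]
  exact hA x a ha

theorem IsAdFinite.exists_submodule {q : Q} (h : IsAdFinite θ q) :
    ∃ A : Submodule k Q, FiniteDimensional k A ∧ q ∈ A ∧
      ∀ (x : L), ∀ a ∈ A, θ (UniversalEnvelopingAlgebra.ι k x) * a -
        a * θ (UniversalEnvelopingAlgebra.ι k x) ∈ A := by
  refine ⟨_, h, ⟨1, by simp⟩, ?_⟩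
  rintro x _ ⟨u, rfl⟩
  refine ⟨UniversalEnvelopingAlgebra.ι k x * u, ?_⟩
  rw [← adAction_ι]
  simp

/-- Leibniz rule for the derivation `[v, ·]`. -/
theorem commutator_mem_pow {R : Type*} [Ring R] [Algebra k R] {W : Submodule k R} {v : R}
    (h : ∀ w ∈ W, v * w - w * v ∈ W) (n : ℕ) : ∀ w ∈ W ^ n, v * w - w * v ∈ W ^ n := by
  induction n with
  | zero =>
    intro w hw
    rw [pow_zero] at hw
    obtain ⟨c, rfl⟩ := Submodule.mem_one.1 hw
    rw [Algebra.commutes, sub_self]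
    exact zero_mem _
  | succ n ih =>
    intro w hw
    rw [pow_succ] at hw ⊢
    refine Submodule.mul_induction_on hw (fun a ha b hb => ?_) (fun a b ha hb => ?_)
    · have : v * (a * b) - a * b * v = (v * a - a * v) * b + a * (v * b - b * v) := by noncomm_ring
      rw [this]
      exact add_mem (Submodule.mul_mem_mul (ih a ha) hb) (Submodule.mul_mem_mul ha (h b hb))
    · have : v * (a + b) - (a + b) * v = (v * a - a * v) + (v * b - b * v) := by noncomm_ring
      rw [this]
      exact add_mem ha hb

/-- An exhaustive filtration of `R` by finite-dimensional subspaces stable under commutation with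
the image of `L`. -/
structure IsAdFiltration {R : Type*} [Ring R] [Algebra k R]
    (π : UniversalEnvelopingAlgebra k L →ₐ[k] R) (F : ℕ → Submodule k R) : Prop where
  mono : Monotone F
  finite (n : ℕ) : FiniteDimensional k (F n)
  exhaustive (r : R) : ∃ n, r ∈ F n
  commutator_mem (x : L) (n : ℕ) : ∀ r ∈ F n, π (UniversalEnvelopingAlgebra.ι k x) * r -
    r * π (UniversalEnvelopingAlgebra.ι k x) ∈ F n

variable {R : Type*} [Ring R] [Algebra k R] {π : UniversalEnvelopingAlgebra k L →ₐ[k] R}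

theorem UniversalEnvelopingAlgebra.map_ι_commutator (x y : L) :
    π (ι k x) * π (ι k y) - π (ι k y) * π (ι k x) = π (ι k ⁅x, y⁆) := by
  rw [LieHom.map_lie, LieRing.of_associative_ring_bracket, map_sub, map_mul, map_mul]

variable [FiniteDimensional k L]

open UniversalEnvelopingAlgebra in
theorem span_range_map_ι_basis :
    Submodule.span k (Set.range fun i => π (ι k (Module.finBasis k L i))) =
      LinearMap.range (π.toLinearMap ∘ₗ (ι k : L →ₗ⁅k⁆ _).toLinearMap) := by
  rw [LinearMap.range_eq_map, ← (Module.finBasis k L).span_eq, Submodule.map_span, ← Set.range_comp]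
  rfl

open UniversalEnvelopingAlgebra in
theorem exists_mem_unitSpan_pow (hπ : Function.Surjective π) (r : R) :
    ∃ n, r ∈ unitSpan k (fun i => π (ι k (Module.finBasis k L i))) ^ n := by
  set W := unitSpan k (fun i => π (ι k (Module.finBasis k L i))) with hW
  have hmono : Monotone fun n => W ^ n := fun m n h => pow_le_pow_right₀ (one_le_unitSpan _) h
  let S : Subalgebra k R :=
    { carrier := {r | ∃ n, r ∈ W ^ n}
      mul_mem' := fun ⟨m, hm⟩ ⟨n, hn⟩ => ⟨m + n, by
        rw [pow_add]
        exact Submodule.mul_mem_mul hm hn⟩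
      add_mem' := fun ⟨m, hm⟩ ⟨n, hn⟩ => ⟨max m n,
        add_mem (hmono (le_max_left m n) hm) (hmono (le_max_right m n) hn)⟩
      algebraMap_mem' := fun c => ⟨0, by
        rw [pow_zero]
        exact Submodule.mem_one.2 ⟨c, rfl⟩⟩ }
  obtain ⟨u, rfl⟩ := hπ r
  refine map_mem_subalgebra π S (fun x => ⟨1, ?_⟩) u
  rw [pow_one, hW, unitSpan, span_range_map_ι_basis]
  exact Submodule.mem_sup_right ⟨x, rfl⟩

open UniversalEnvelopingAlgebra in
theorem UniversalEnvelopingAlgebra.isNoetherian_of_surjective (hπ : Function.Surjective π) : IsNoetherian Rᵐᵒᵖ R := by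
  refine isNoetherian_of_commutators_mem_span (k := k)
    (x := fun i => π (ι k (Module.finBasis k L i))) (fun i j => ?_) (exists_mem_unitSpan_pow hπ)
  rw [map_ι_commutator, span_range_map_ι_basis]
  exact ⟨_, rfl⟩

open UniversalEnvelopingAlgebra in
theorem exists_isAdFiltration (hπ : Function.Surjective π) :
    ∃ F : ℕ → Submodule k R, IsAdFiltration π F := by
  refine ⟨fun n => unitSpan k (fun i => π (ι k (Module.finBasis k L i))) ^ n,
    fun m n h => pow_le_pow_right₀ (one_le_unitSpan _) h, fun n => ?_,
    exists_mem_unitSpan_pow hπ, fun x n => commutator_mem_pow (fun w hw => ?_) n⟩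
  · refine (Submodule.fg_iff_finiteDimensional _).1 (Submodule.FG.pow ?_ n)
    exact Submodule.FG.sup (Submodule.one_eq_span (R := k) (A := R) ▸ Submodule.fg_span_singleton 1)
      (Submodule.fg_span (Set.finite_range _))
  · obtain ⟨c, hc, v, hv, rfl⟩ := Submodule.mem_sup.1 hw
    obtain ⟨c, rfl⟩ := Submodule.mem_one.1 hc
    rw [span_range_map_ι_basis] at hv
    obtain ⟨y, rfl⟩ := hv
    rw [unitSpan, span_range_map_ι_basis]
    refine Submodule.mem_sup_right ⟨⁅x, y⁆, ?_⟩
    refine (map_ι_commutator (π := π) x y).symm.trans ?_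
    rw [mul_add, add_mul, Algebra.commutes]
    exact (add_sub_add_left_eq_sub _ _ _).symm

end AdFinite

/-! ### The image of the embedding -/

section Image

open AmitsurMartindale MulOpposite

variable {k L : Type*} [Field k] [LieRing L] [LieAlgebra k L] {R Q : Type*} [Ring R] [Algebra k R]
  [Ring Q] [Algebra k Q] {π : UniversalEnvelopingAlgebra k L →ₐ[k] R} {φ : R →ₐ[k] Q}

/-- If `q I ⊆ R` for a two-sided ideal `I` containing a regular element, then `q` is ad-finite. -/
theorem isAdFinite_of_mul_mem_range {F : ℕ → Submodule k R} (hF : IsAdFiltration π F)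
    {I : Submodule Rᵐᵒᵖ R} (hI : MemFilter I) {s : R} (hsI : s ∈ I) (hs : IsUnit (φ s)) {q : Q}
    (hq : ∀ r ∈ I, ∃ b, q * φ r = φ b) : IsAdFinite (φ.comp π) q := by
  obtain ⟨n, hn⟩ := hF.exhaustive s
  have := hF.finite n
  let V : Submodule k R := F n ⊓ I.restrictScalars k
  have : FiniteDimensional k V := Submodule.finiteDimensional_of_le inf_le_left
  have hV : ∀ (x : L), ∀ v ∈ V, π (UniversalEnvelopingAlgebra.ι k x) * v -
      v * π (UniversalEnvelopingAlgebra.ι k x) ∈ V := fun x v hv =>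
    ⟨hF.commutator_mem x n v hv.1, I.sub_mem (hI.mul_mem_left _ hv.2) (mul_mem_right I hv.2 _)⟩
  let f : V →ₗ[k] Q := LinearMap.mulLeft k q ∘ₗ φ.toLinearMap ∘ₗ V.subtype
  -- The subspaces `{v ∈ V | qv ∈ F m}` increase and exhaust `V`; as `V` is finite dimensional, one
  -- of them is all of `V`.
  let G : ℕ →o Submodule k V :=
    ⟨fun m => ((F m).map φ.toLinearMap).comap f, fun _ _ h =>
      Submodule.comap_mono (Submodule.map_mono (hF.mono h))⟩
  obtain ⟨m, hm⟩ := monotone_stabilizes_iff_noetherian.2 (inferInstance : IsNoetherian k V) G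
  have hqV : ∀ v ∈ V, ∃ b ∈ F m, φ b = q * φ v := by
    intro v hv
    obtain ⟨b, hb⟩ := hq v hv.2
    obtain ⟨l, hl⟩ := hF.exhaustive b
    have h1 : (⟨v, hv⟩ : V) ∈ G l := ⟨b, hl, hb.symm⟩
    have h2 : (⟨v, hv⟩ : V) ∈ G m := by
      rw [hm _ (le_max_left m l)]
      exact G.monotone (le_max_right m l) h1
    exact h2
  have := hF.finite m
  let A : Submodule k Q :=
    { carrier := {p | ∀ v ∈ V, p * φ v ∈ (F m).map φ.toLinearMap}
      zero_mem' := fun v _ => by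
        rw [zero_mul]
        exact zero_mem _
      add_mem' := fun h h' v hv => by
        rw [add_mul]
        exact add_mem (h v hv) (h' v hv)
      smul_mem' := fun c p h v hv => by
        rw [smul_mul_assoc]
        exact Submodule.smul_mem _ c (h v hv) }
  have hA : FiniteDimensional k A := by
    refine Module.Finite.of_injective
      ((LinearMap.mulRight k (φ s)).restrict (p := A) (q := (F m).map φ.toLinearMap)
        fun p hp => hp s ⟨hn, hsI⟩) fun a b hab => ?_
    exact Subtype.ext (hs.mul_right_cancel (congrArg Subtype.val hab))
  refine isAdFinite_of_mem (A := A) (fun x a ha v hv => ?_) hqV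
  set y := π (UniversalEnvelopingAlgebra.ι k x) with hy
  obtain ⟨b, hb, hba⟩ := ha v hv
  obtain ⟨c, hc, hca⟩ := ha _ (hV x v hv)
  -- The identity `[y, a]v = [y, av] - a[y, v]`, with `b = av` and `c = a[y, v]`.
  refine ⟨(y * b - b * y) - c, sub_mem (hF.commutator_mem x m b hb) hc, ?_⟩
  simp only [AlgHom.toLinearMap_apply] at hba hca
  simp only [AlgHom.toLinearMap_apply, AlgHom.comp_apply, ← hy, map_sub, map_mul, hba, hca]
  noncomm_ring

theorem IsClassicalRingOfQuotients.exists_common_denominator [IsNoetherian Rᵐᵒᵖ R]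
    (hR : IsSemiprimeRing R) (hφ : IsClassicalRingOfQuotients (φ : R →+* Q)) {A : Submodule k Q} (hA : A.FG) :
    ∃ s ∈ nonZeroDivisors R, ∀ a ∈ A, ∃ b, a * φ s = φ b := by
  induction A, hA using Submodule.fg_induction with
  | singleton q =>
    obtain ⟨b, s, hs, hb⟩ := hφ.exists_fraction q
    refine ⟨s, hs, fun a ha => ?_⟩
    obtain ⟨c, rfl⟩ := Submodule.mem_span_singleton.1 ha
    exact ⟨c • b, by rw [smul_mul_assoc, map_smul]; exact congrArg (c • ·) hb⟩
  | sup A B _ _ hA hB =>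
    obtain ⟨s, hs, hsA⟩ := hA
    obtain ⟨t, ht, htB⟩ := hB
    -- The Ore relation `su = tv` makes `su` a denominator for both `A` and `B`.
    obtain ⟨v, u, hu, huv⟩ := hR.exists_ore s ht
    refine ⟨s * u, mul_mem hs hu, fun a ha => ?_⟩
    obtain ⟨y, hy, z, hz, rfl⟩ := Submodule.mem_sup.1 ha
    obtain ⟨b, hb⟩ := hsA y hy
    obtain ⟨c, hc⟩ := htB z hz
    refine ⟨b * u + c * v, ?_⟩
    rw [add_mul, map_add, map_mul φ b, map_mul φ c, ← hb, ← hc, mul_assoc, ← map_mul, mul_assoc,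
      ← map_mul, huv]

/-- An ad-finite element multiplies some ideal in the filter into `R`. -/
theorem IsAdFinite.exists_memFilter [IsNoetherian Rᵐᵒᵖ R] (hπ : Function.Surjective π)
    (hR : IsSemiprimeRing R) (hφ : IsClassicalRingOfQuotients (φ : R →+* Q)) {q : Q}
    (hq : IsAdFinite (φ.comp π) q) :
    ∃ I : Submodule Rᵐᵒᵖ R, MemFilter I ∧ ∀ r ∈ I, ∃ b, q * φ r = φ b := by
  obtain ⟨A, hA, hqA, hstab⟩ := hq.exists_submodule
  obtain ⟨s, hs, hsA⟩ :=
    hφ.exists_common_denominator hR ((Submodule.fg_iff_finiteDimensional A).2 hA)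
  let I : Submodule Rᵐᵒᵖ R :=
    { carrier := {r | ∀ a ∈ A, ∃ b, a * φ r = φ b}
      zero_mem' := fun a _ => ⟨0, by simp⟩
      add_mem' := fun {r r'} h h' a ha => by
        obtain ⟨b, hb⟩ := h a ha
        obtain ⟨c, hc⟩ := h' a ha
        exact ⟨b + c, by rw [map_add, mul_add, hb, hc, map_add]⟩
      smul_mem' := fun c r h a ha => by
        obtain ⟨b, hb⟩ := h a ha
        exact ⟨b * c.unop, by rw [smul_eq_mul_unop, map_mul, ← mul_assoc, hb, map_mul]⟩ }
  let S : Subalgebra k R :=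
    { carrier := {y | ∀ r ∈ I, y * r ∈ I}
      mul_mem' := fun {y z} h h' r hr => by
        rw [mul_assoc]
        exact h _ (h' r hr)
      add_mem' := fun {y z} h h' r hr => by
        rw [add_mul]
        exact I.add_mem (h r hr) (h' r hr)
      algebraMap_mem' := fun c r hr => by
        rw [Algebra.commutes]
        exact mul_mem_right I hr _ }
  refine ⟨I, ⟨fun y r hr => ?_, fun r hr => ?_⟩, fun r hr => hr q hqA⟩
  · obtain ⟨u, rfl⟩ := hπ y
    refine UniversalEnvelopingAlgebra.map_mem_subalgebra π S (fun x r hr a ha => ?_) u r hr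
    set y := π (UniversalEnvelopingAlgebra.ι k x) with hy
    obtain ⟨b, hb⟩ := hr a ha
    obtain ⟨c, hc⟩ := hr _ (hstab x a ha)
    -- Ad-stability of `A` makes `I` a left ideal: `a(yr) = y(ar) - [y, a]r`.
    refine ⟨y * b - c, ?_⟩
    rw [map_sub, map_mul, map_mul, ← hb, ← hc, AlgHom.comp_apply, ← hy]
    noncomm_ring
  -- The common denominator `s` lies in `I` and is regular.
  · exact (mem_nonZeroDivisors_iff.1 hs).2 r (hr s hsA)

/-- An element `q` with `q I ⊆ R` defines a right module map `I → R`. -/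
theorem exists_isRepresentedBy (hφ : Function.Injective φ) {I : Submodule Rᵐᵒᵖ R}
    (hI : MemFilter I) {q : Q} (hq : ∀ r ∈ I, ∃ b, q * φ r = φ b) :
    ∃ f : PartialHom R, f.IsRepresentedBy (φ : R →+* Q) q := by
  choose f hf using hq
  exact ⟨⟨⟨I,
    { toFun := fun r => f r r.2
      map_add' := fun r s => hφ (by
        rw [← hf, map_add, ← hf, ← hf, Submodule.coe_add, map_add, mul_add])
      map_smul' := fun c r => hφ (by
        rw [RingHom.id_apply, ← hf, Submodule.coe_smul, smul_eq_mul_unop, smul_eq_mul_unop,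
          map_mul, map_mul, ← hf, mul_assoc]) }⟩, hI⟩, fun r hr => hf r hr⟩

end Image

theorem mainTheorem10 {k : Type*} [Field k] {L : Type*} [LieRing L] [LieAlgebra k L]
    [FiniteDimensional k L] {R : Type u} [Ring R] [Algebra k R]
    (π : UniversalEnvelopingAlgebra k L →ₐ[k] R) (hπ : Function.Surjective π)
    (hR : IsSemiprimeRing R) :
    (∃ (Q : Type u) (_ : Ring Q) (_ : Algebra k Q) (φ : R →ₐ[k] Q),
      IsClassicalRingOfQuotients (φ : R →+* Q)) ∧
    ∀ (Q : Type v) [Ring Q] [Algebra k Q] (φ : R →ₐ[k] Q),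
      IsClassicalRingOfQuotients (φ : R →+* Q) →
      ∃ ψ : RightQuotients R →+* Q, Function.Injective ψ ∧
        (∀ r : R, ψ (RightQuotients.ofRing r) = φ r) ∧
        ∀ q : Q, q ∈ Set.range ψ ↔ IsAdFinite (φ.comp π) q := by
  have hN := UniversalEnvelopingAlgebra.isNoetherian_of_surjective hπ
  refine ⟨exists_isClassicalRingOfQuotients k fun a s hs => hR.exists_ore a hs, ?_⟩
  intro Q _ _ φ hφ
  obtain ⟨ψ, hψ⟩ := RightQuotients.exists_ringHom hR hφ
  refine ⟨ψ, ?_, fun r => (hψ _ _).2 (.lmul _ r), fun q => ⟨?_, fun hq => ?_⟩⟩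
  · refine RightQuotients.ind fun f => RightQuotients.ind fun g => fun h => ?_
    exact RightQuotients.mk_eq_mk.2 (((hψ f _).1 h).rel hφ.injective ((hψ g _).1 rfl))
  · rintro ⟨p, rfl⟩
    induction p using RightQuotients.ind with | _ f
    obtain ⟨F, hF⟩ := exists_isAdFiltration hπ
    obtain ⟨s, hsI, hs⟩ := hR.exists_mem_nonZeroDivisors f.2.isEssentialRight
    exact isAdFinite_of_mul_mem_range hF f.2 hsI (hφ.isUnit_map s hs) fun r hr =>
      ⟨_, (hψ f _).1 rfl r hr⟩
  · obtain ⟨I, hI, hqI⟩ := hq.exists_memFilter hπ hR hφ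
    obtain ⟨f, hf⟩ := exists_isRepresentedBy hφ.injective hI hqI
    exact ⟨_, (hψ f q).2 hf⟩
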